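/- \textbf{Theorem 3.} Let $G$ be a connected undirected graph on $N\ge 2$ nodes; let $\mathscr V_i$ be the set of neighbours of node $i$ and $V_i=|\mathscr V_i|$. Node $i$ holds a dataset $D_i=\{(x_i^n,y_i^n)\}_{n=1}^{B_i}$ with $x_i^n\in\mathbb R^d$, $y_i^n\in\{-1,1\}$. Let $\rho>0$, $0<C\le B_i$ for all $i$, and $$O(f,D_i)=\frac{C}{B_i}\sum_{n=1}^{B_i}\mathscr L(y_i^n f^Tx_i^n)+\frac{\rho}{N}R(f),\qquad f\in\mathbb R^d .$$ Assume that $\mathscr L:\mathbb R\to\mathbb R$ is strictly convex and twice differentiable with $|\mathscr L'|\le 1$ and $0<\mathscr L''\le c_1$ for a constant $c_1$, and that $R:\mathbb R^d\to\mathbb R$ is $1$-strongly convex and twice continuously differentiable. Let the dual step size $\theta$ satisfy $2c_1<\frac{B_i}{C}\left(\frac{\rho}{N}+2\theta V_i\right)$ for all $i$, and let the penalties $\eta_i(t)>0$ and noise parameters $\alpha_i(t)>0$ ($1\le t\le T$) be given, independent of the data. The penalty-perturbation private M-ADMM runs as follows. The initial values $(f_i(0))_i$ are drawn from a joint law that does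 not depend on the data, and $\lambda_i(0)=0$. For $t=0,\dots,T-1$, every node $i$ draws a noise vector $\epsilon_i(t+1)\in\mathbb R^d$ with density proportional to $\exp(-\alpha_i(t+1)\|\epsilon\|_2)$, independent of all other noise vectors and of the initial values, and computes $$f_i(t+1)=\operatorname*{argmin}_{f}\Big\{O(f,D_i)+2\lambda_i(t)^Tf+\eta_i(t+1)\sum_{j\in\mathscr V_i}\big\|f+\epsilon_i(t+1)-\tfrac12(f_i(t)+f_j(t))\big\|_2^2\Big\},$$ broadcasts it to its neighbours, and then sets $\lambda_i(t+1)=\lambda_i(t)+\frac{\theta}{2}\sum_{j\in\mathscr V_i}(f_i(t+1)-f_j(t+1))$. If $$\beta\ \ge\ \max_{i}\ \sum_{t=1}^{T}\frac{C\,(1.4\,c_1+\alpha_i(t))}{\eta_i(t)V_iB_i},$$ then this algorithm is $\beta$-differentially private during $T$ iterations on normalized data. That is, let $D_{all}=(D_i)_i$ and $\hat D_{all}=(\hat D_i)_i$ be any two collections of datasets with the same sizes $B_i$ that differ in at most one data point and whose feature vectors all have norm $\|x\|_2\le 1$. Then, for every measurable set $S$ of sequences of iterates, $$\Pr\big(\{f(t)\}_{t=0}^T\in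 S\mid D_{all}\big)\le e^{\beta}\,\Pr\big(\{f(t)\}_{t=0}^T\in S\mid \hat D_{all}\big),$$ where $f(t)=(f_i(t))_i$ is the collection of the values of all nodes after iteration $t$. -/

import Mathlib

open MeasureTheory

noncomputable section

/-- A labelled training sample: a feature vector in `ℝᵈ` and a label in `{-1, 1}`. -/
@[ext]
structure Sample (d : ℕ) where
  x : EuclideanSpace ℝ (Fin d)
  y : ℝ
  label : y = -1 ∨ y = 1

/-- The data-independent ingredients of the learning problem and of the algorithm, for a network
with nodes `0, …, N - 1` and features in `ℝᵈ`. Only data; all assumptions are stated separately. -/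
structure Setup (N d : ℕ) where
  /-- the network -/
  graph : SimpleGraph (Fin N)
  /-- the number of samples held by each node -/
  B : Fin N → ℕ
  /-- the weight of the empirical loss -/
  C : ℝ
  /-- the weight of the regularizer -/
  ρ : ℝ
  /-- the loss function -/
  loss : ℝ → ℝ
  /-- the regularizer -/
  reg : EuclideanSpace ℝ (Fin d) → ℝ
  /-- the dual updating step size -/
  θ : ℝ
  /-- `η i t` is the penalty parameter of node `i` in iteration `t` (`t = 1, 2, …`) -/
  η : Fin N → ℕ → ℝ
  /-- `α i t` is the noise parameter of node `i` in iteration `t` (`t = 1, 2, …`) -/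
  α : Fin N → ℕ → ℝ

/-- The loss is strictly convex and twice differentiable, `|L'| ≤ 1` and `0 < L'' ≤ c₁`. -/
structure LossCondition (L : ℝ → ℝ) (c₁ : ℝ) : Prop where
  strictConvex : StrictConvexOn ℝ Set.univ L
  differentiable : Differentiable ℝ L
  differentiable_deriv : Differentiable ℝ (deriv L)
  abs_deriv_le : ∀ z, |deriv L z| ≤ 1
  deriv2_pos : ∀ z, 0 < deriv (deriv L) z
  deriv2_le : ∀ z, deriv (deriv L) z ≤ c₁

/-- The regularizer is `1`-strongly convex and twice continuously differentiable. -/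
structure RegularizerCondition {d : ℕ} (R : EuclideanSpace ℝ (Fin d) → ℝ) : Prop where
  strongConvex : StrongConvexOn Set.univ 1 R
  contDiff : ContDiff ℝ 2 R

/-- A global minimizer of `F` (an arbitrary point if there is none). -/
def argmin {E : Type*} [Nonempty E] (F : E → ℝ) : E :=
  Classical.epsilon fun f => ∀ g, F f ≤ F g

/-- The probability measure on `ℝᵈ` with density proportional to `exp (-a ‖ε‖)`. -/
def noiseMeasure (d : ℕ) (a : ℝ) : Measure (EuclideanSpace ℝ (Fin d)) :=
  (∫⁻ e : EuclideanSpace ℝ (Fin d), ENNReal.ofReal (Real.exp (-a * ‖e‖)))⁻¹ •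
    (volume : Measure (EuclideanSpace ℝ (Fin d))).withDensity
      fun e => ENNReal.ofReal (Real.exp (-a * ‖e‖))

namespace Setup

variable {N d : ℕ} (S : Setup N d)

/-- The datasets of all nodes; sample `n` of node `i` is `D i n`. -/
abbrev Dataset : Type := (i : Fin N) → Fin (S.B i) → Sample d

/-- All feature vectors have Euclidean norm at most one. -/
def IsNormalized (D : S.Dataset) : Prop := ∀ i n, ‖(D i n).x‖ ≤ 1

/-- `D` and `D'` differ in at most one data point. -/
def Neighboring (D D' : S.Dataset) : Prop :=
  {k : (i : Fin N) × Fin (S.B i) | D k.1 k.2 ≠ D' k.1 k.2}.ncard ≤ 1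

open Classical in
/-- The set of neighbours of node `i`. -/
def nbrs (i : Fin N) : Finset (Fin N) := Finset.univ.filter fun j => S.graph.Adj i j

/-- The number `V_i` of neighbours of node `i`. -/
def V (i : Fin N) : ℕ := (S.nbrs i).card

/-- The local objective `O(f, D_i)`. -/
def localObj (D : S.Dataset) (i : Fin N) (f : EuclideanSpace ℝ (Fin d)) : ℝ :=
  S.C / S.B i * ∑ n, S.loss ((D i n).y * inner ℝ f (D i n).x) + S.ρ / N * S.reg f

/-- The objective minimized by node `i` in iteration `t`, where `fp` are the primal variables of
all nodes and `lam` is the dual variable of node `i` after iteration `t - 1`, and `e` is the noise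
of node `i`. -/
def privObj (D : S.Dataset) (i : Fin N) (t : ℕ) (fp : Fin N → EuclideanSpace ℝ (Fin d))
    (lam e f : EuclideanSpace ℝ (Fin d)) : ℝ :=
  S.localObj D i f + 2 * inner ℝ lam f
    + S.η i t * ∑ j ∈ S.nbrs i, ‖f + e - (1 / 2 : ℝ) • (fp i + fp j)‖ ^ 2

/-- The primal variables (first component) and dual variables (second component) of all nodes after
`t` iterations, started from `f0` and zero dual variables; `e t i` is the noise that node `i` uses
in iteration `t + 1`. -/
def run (D : S.Dataset) (f0 : Fin N → EuclideanSpace ℝ (Fin d))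
    (e : ℕ → Fin N → EuclideanSpace ℝ (Fin d)) :
    ℕ → (Fin N → EuclideanSpace ℝ (Fin d)) × (Fin N → EuclideanSpace ℝ (Fin d))
  | 0 => (f0, 0)
  | t + 1 =>
    let s := run D f0 e t
    let f' : Fin N → EuclideanSpace ℝ (Fin d) :=
      fun i => argmin (S.privObj D i (t + 1) s.1 (s.2 i) (e t i))
    (f', fun i => s.2 i + (S.θ / 2) • ∑ j ∈ S.nbrs i, (f' i - f' j))

/-- The randomness of `T` iterations: the initial values of all nodes, and one noise vector for
each node in each iteration. -/
abbrev Randomness (_ : Setup N d) (T : ℕ) : Type :=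
  (Fin N → EuclideanSpace ℝ (Fin d)) × (Fin T → Fin N → EuclideanSpace ℝ (Fin d))

/-- The joint law of the randomness: the initial values have law `μ₀`, and the noise vectors are
independent of them and of each other, that of node `i` in iteration `t + 1` having density
proportional to `exp (-α_i(t + 1) ‖ε‖)`. -/
def randLaw (T : ℕ) (μ₀ : Measure (Fin N → EuclideanSpace ℝ (Fin d))) :
    Measure (S.Randomness T) :=
  μ₀.prod (Measure.pi fun t : Fin T => Measure.pi fun i : Fin N =>
    noiseMeasure d (S.α i ((t : ℕ) + 1)))

/-- Everything that is exchanged during `T` iterations: the primal variables `f_i(t)` of all nodes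
for `t = 0, …, T`. -/
def exchanged (T : ℕ) (D : S.Dataset) (ω : S.Randomness T) :
    Fin (T + 1) → Fin N → EuclideanSpace ℝ (Fin d) :=
  fun t => (S.run D ω.1 (fun s => if h : s < T then ω.2 ⟨s, h⟩ else 0) t).1

/-- `β`-differential privacy during `T` iterations, on normalized datasets: for any two
neighbouring datasets, the probability that the sequence of exchanged iterates lies in a given set
changes at most by the factor `exp β`. -/
def IsDifferentiallyPrivate (T : ℕ) (μ₀ : Measure (Fin N → EuclideanSpace ℝ (Fin d))) (β : ℝ) :
    Prop :=
  ∀ D D' : S.Dataset, S.IsNormalized D → S.IsNormalized D' → S.Neighboring D D' →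
    ∀ A : Set (Fin (T + 1) → Fin N → EuclideanSpace ℝ (Fin d)), MeasurableSet A →
      S.randLaw T μ₀ {ω | S.exchanged T D ω ∈ A} ≤
        ENNReal.ofReal (Real.exp β) * S.randLaw T μ₀ {ω | S.exchanged T D' ω ∈ A}

end Setup

end

/-! ### Gradients of convex functions and existence of minimizers. -/

section ConvexGradient

variable {E : Type*} [NormedAddCommGroup E] [InnerProductSpace ℝ E]

/-! Fix the past. The first-order condition says that the next iterate `f` of a node solves `G f = w
- ε`, where `G = id + κ ∇O` with `κ = 1 / (2 η V)`, `w` depends only on the past, and `ε` is the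
noise. Since `∇O` is monotone, `G` is a bijection with a 1-Lipschitz inverse, so up to a constant
the law of `f` has density `|det DG(f)| exp (-α ‖w - G f‖)`. Replacing one sample has two effects.
It moves `G f` by at most `2 κ C / B`, because each sample contributes a vector of norm at most 1 to
the gradient sum; this costs a factor `exp (α C / (η V B))`. It also exchanges one rank-one term of
`DG`, and by the matrix determinant lemma this costs at most `exp (κ C c₁ / B)`, well within the
allowance `1.4 c₁`. These are `map_noiseMeasure_le` and `abs_det_add_rankOne_le`, combined in
`map_argmin_privObj_le`. Given the past, the nodes move independently and only one of them holds the
changed sample, so the bound passes to the product law (`map_primalStep_le`). The iterates and duals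
form a Markov chain, and the factors of successive iterations multiply (`map_history_le`). -/

theorem ConvexOn.add_fderiv_le {H : E → ℝ} (hH : ConvexOn ℝ Set.univ H) {H' : E →L[ℝ] ℝ} {f : E}
    (hf : HasFDerivAt H H' f) (g : E) : H f + H' (g - f) ≤ H g := by
  have hline : HasDerivAt (fun s : ℝ => H (f + s • (g - f))) (H' (g - f)) 0 := by
    have h1 : HasDerivAt (fun s : ℝ => f + s • (g - f)) (g - f) 0 := by
      simpa using ((hasDerivAt_id (0 : ℝ)).smul_const (g - f)).const_add f
    have hf' : HasFDerivAt H H' (f + (0 : ℝ) • (g - f)) := by simpa using hf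
    exact hf'.comp_hasDerivAt (0 : ℝ) h1
  have hconv : ConvexOn ℝ Set.univ (fun s : ℝ => H (f + s • (g - f))) := by
    have := hH.comp_affineMap (AffineMap.lineMap f g : ℝ →ᵃ[ℝ] E)
    refine (this.congr fun s _ => ?_)
    simp [AffineMap.lineMap_apply, add_comm]
  have := hconv.le_slope_of_hasDerivAt (Set.mem_univ 0) (Set.mem_univ 1) zero_lt_one hline
  simp [slope_def_field, -map_sub] at this
  linarith

theorem ConvexOn.inner_sub_nonneg {H : E → ℝ} (hH : ConvexOn ℝ Set.univ H) {h : E → E}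
    (hh : ∀ f, HasFDerivAt H (innerSL ℝ (h f)) f) (f g : E) : 0 ≤ inner ℝ (h f - h g) (f - g) := by
  have h1 := hH.add_fderiv_le (hh f) g
  have h2 := hH.add_fderiv_le (hh g) f
  simp only [innerSL_apply_apply, inner_sub_right, inner_sub_left] at *
  linarith

/-- The derivative of a monotone operator is positive semidefinite. -/
theorem inner_fderiv_nonneg_of_monotone {h : E → E} (hh : ∀ f g, 0 ≤ inner ℝ (h f - h g) (f - g))
    {M : E →L[ℝ] E} {f : E} (hM : HasFDerivAt h M f) (v : E) : 0 ≤ inner ℝ (M v) v := by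
  have hline : HasDerivAt (fun s : ℝ => inner ℝ (h (f + s • v)) v) (inner ℝ (M v) v) 0 := by
    have h1 : HasDerivAt (fun s : ℝ => f + s • v) v 0 := by
      simpa using ((hasDerivAt_id (0 : ℝ)).smul_const v).const_add f
    have hM' : HasFDerivAt h M (f + (0 : ℝ) • v) := by simpa using hM
    simpa using (hM'.comp_hasDerivAt (0 : ℝ) h1).inner ℝ (hasDerivAt_const (0 : ℝ) v)
  have hmono : Monotone (fun s : ℝ => inner ℝ (h (f + s • v)) v : ℝ → ℝ) := by
    intro s t hst
    rcases hst.eq_or_lt with rfl | hst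
    · exact le_rfl
    have h1 := hh (f + t • v) (f + s • v)
    have h2 : f + t • v - (f + s • v) = (t - s) • v := by rw [sub_smul]; abel
    rw [h2, inner_smul_right] at h1
    have := (mul_nonneg_iff_of_pos_left (sub_pos.2 hst)).1 h1
    rw [inner_sub_left] at this
    simpa using this
  rw [← hline.deriv]
  exact hmono.deriv_nonneg

/-- The penalized objective of a differentiable convex function is minimized by some point. -/
theorem ConvexOn.exists_isMinOn_add_quadratic [FiniteDimensional ℝ E] {H : E → ℝ}
    (hH : ConvexOn ℝ Set.univ H) {h : E → E}
    (hh : ∀ f, HasFDerivAt H (innerSL ℝ (h f)) f) {c : ℝ} (hc : 0 < c) (l : E) :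
    ∃ a, ∀ g, H a + inner ℝ l a + c * ‖a‖ ^ 2 ≤ H g + inner ℝ l g + c * ‖g‖ ^ 2 := by
  have hcont : Continuous fun g => H g + inner ℝ l g + c * ‖g‖ ^ 2 := by
    have : Continuous H := continuous_iff_continuousAt.2 fun f => (hh f).continuousAt
    fun_prop
  refine hcont.exists_forall_le ?_
  -- Coercivity: the tangent of `H` at 0 and Cauchy-Schwarz leave a lower bound that the quadratic
  -- term dominates.
  have hb : ∀ g, H 0 + ‖g‖ * (c * ‖g‖ - ‖h 0 + l‖) ≤ H g + inner ℝ l g + c * ‖g‖ ^ 2 := by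
    intro g
    have h1 := hH.add_fderiv_le (hh 0) g
    have h2 := neg_le_of_abs_le (abs_real_inner_le_norm (h 0 + l) g)
    simp only [innerSL_apply_apply, sub_zero, inner_add_left] at h1 h2
    nlinarith
  refine Filter.tendsto_atTop_mono hb ?_
  have hn : Filter.Tendsto (fun g : E => ‖g‖) (Filter.cocompact E) Filter.atTop :=
    tendsto_norm_cocompact_atTop
  refine Filter.tendsto_atTop_add_const_left _ _ (hn.atTop_mul_atTop₀ ?_)
  simpa [sub_eq_add_neg] using
    Filter.tendsto_atTop_add_const_right _ (-‖h 0 + l‖) (hn.const_mul_atTop hc)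

end ConvexGradient

/-! ### The map `id + κ ∇H` is a bijection. -/

section RegularizedMap

variable {E : Type*} [NormedAddCommGroup E] [InnerProductSpace ℝ E]

/-- The identity plus a multiple of a gradient map. -/
def regularizedMap (κ : ℝ) (h : E → E) (f : E) : E := f + κ • h f

/-- Monotonicity of `h` gives `‖f - g‖² ≤ ⟪G f - G g, f - g⟫`; Cauchy-Schwarz does the rest. This
provides both injectivity of `G` and continuity of its inverse. -/
theorem antilipschitzWith_regularizedMap {κ : ℝ} (hκ : 0 ≤ κ) {h : E → E}
    (hh : ∀ f g, 0 ≤ inner ℝ (h f - h g) (f - g)) : AntilipschitzWith 1 (regularizedMap κ h) := by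
  refine AntilipschitzWith.of_le_mul_dist fun f g => ?_
  simp only [NNReal.coe_one, one_mul, dist_eq_norm]
  rcases eq_or_ne f g with rfl | hfg
  · simp
  have h1 : ‖f - g‖ ^ 2 ≤ inner ℝ (regularizedMap κ h f - regularizedMap κ h g) (f - g) := by
    have : regularizedMap κ h f - regularizedMap κ h g = (f - g) + κ • (h f - h g) := by
      simp only [regularizedMap, smul_sub]; abel
    rw [this, inner_add_left, real_inner_self_eq_norm_sq, inner_smul_left]
    have := mul_nonneg hκ (hh f g)
    simpa using this
  have h2 := real_inner_le_norm (regularizedMap κ h f - regularizedMap κ h g) (f - g)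
  have h3 : 0 < ‖f - g‖ := norm_pos_iff.2 (sub_ne_zero.2 hfg)
  nlinarith

/-- The first-order condition characterizing the minimizer of a penalized convex objective. -/
theorem regularizedMap_eq_of_isMin {H : E → ℝ} {h : E → E}
    (hh : ∀ f, HasFDerivAt H (innerSL ℝ (h f)) f) {c : ℝ} (hc : 0 < c) {l a : E}
    (ha : ∀ g, H a + inner ℝ l a + c * ‖a‖ ^ 2 ≤ H g + inner ℝ l g + c * ‖g‖ ^ 2) :
    regularizedMap (1 / (2 * c)) h a = -(1 / (2 * c)) • l := by
  have hd : HasFDerivAt (fun g => H g + inner ℝ l g + c * ‖g‖ ^ 2)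
      (innerSL ℝ (h a) + innerSL ℝ l + c • (2 • innerSL ℝ a)) a :=
    ((hh a).add (innerSL ℝ l).hasFDerivAt).add ((hasStrictFDerivAt_norm_sq a).hasFDerivAt.const_mul c)
  have hmin : IsLocalMin (fun g => H g + inner ℝ l g + c * ‖g‖ ^ 2) a :=
    Filter.Eventually.of_forall ha
  have h0 := hmin.hasFDerivAt_eq_zero hd
  have h1 : h a + l + (2 * c) • a = 0 := by
    refine ext_inner_right ℝ fun v => ?_
    have := congrArg (fun L : E →L[ℝ] ℝ => L v) h0
    simp at this
    simp only [inner_add_left, inner_smul_left, inner_zero_left]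
    simp
    linarith
  have h2 : h a = -l - (2 * c) • a := by
    rw [eq_sub_iff_add_eq, eq_neg_iff_add_eq_zero, ← h1]; abel
  have h3 : (1 / (2 * c)) * (2 * c) = 1 := by field_simp
  rw [regularizedMap, h2, smul_sub, smul_smul, h3]
  simp

/-- The equation `G a = u` is the first-order condition for minimizing `H` with the linear term `-2
c u` and the penalty `c ‖·‖²`. -/
theorem surjective_regularizedMap [FiniteDimensional ℝ E] {H : E → ℝ}
    (hH : ConvexOn ℝ Set.univ H) {h : E → E}
    (hh : ∀ f, HasFDerivAt H (innerSL ℝ (h f)) f) {c : ℝ} (hc : 0 < c) :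
    Function.Surjective (regularizedMap (1 / (2 * c)) h) := by
  intro u
  obtain ⟨a, ha⟩ := hH.exists_isMinOn_add_quadratic hh hc (-(2 * c) • u)
  refine ⟨a, ?_⟩
  rw [regularizedMap_eq_of_isMin hh hc ha, smul_smul]
  have : -(1 / (2 * c)) * -(2 * c) = 1 := by field_simp
  rw [this, one_smul]

end RegularizedMap

/-! ### Determinants under rank-one perturbation. -/

section RankOneDet

variable {E : Type*} [NormedAddCommGroup E] [InnerProductSpace ℝ E] [FiniteDimensional ℝ E]

/-- The matrix determinant lemma for a perturbation `q x xᵀ` of an operator bounded below by the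
identity: the factor lies between `1` and `1 + q ‖x‖²`. -/
theorem exists_det_add_rankOne {A : E →L[ℝ] E} (hA : ∀ v, ‖v‖ ^ 2 ≤ inner ℝ (A v) v)
    (x : E) :
    ∃ r, 0 ≤ r ∧ r ≤ ‖x‖ ^ 2 ∧
      ∀ q : ℝ, (A + q • (innerSL ℝ x).smulRight x).det = A.det * (1 + q * r) := by
  have hinj : Function.Injective A := by
    refine (injective_iff_map_eq_zero A).2 fun v hv => ?_
    have := hA v
    rw [hv, inner_zero_left] at this
    simpa using le_antisymm this (sq_nonneg _)
  -- With `z = A⁻¹ x` the factor is `r = ⟪x, z⟫`, and `‖z‖² ≤ ⟪x, z⟫ ≤ ‖x‖ ‖z‖` gives both bounds on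
  -- it.
  obtain ⟨z, hz⟩ := (LinearMap.injective_iff_surjective (f := (A : E →ₗ[ℝ] E))).1 hinj x
  have hz : A z = x := hz
  have h1 := hA z
  rw [hz] at h1
  have h2 := real_inner_le_norm x z
  have h3 : ‖z‖ ≤ ‖x‖ := by
    by_contra! hlt
    nlinarith [norm_nonneg x]
  refine ⟨inner ℝ x z, (sq_nonneg _).trans h1, by nlinarith [norm_nonneg x], fun q => ?_⟩
  -- Factor `A + q x xᵀ = A (1 + q z xᵀ)`; the second factor has determinant `1 + q ⟪x, z⟫`.
  have hcomp : ((A + q • (innerSL ℝ x).smulRight x : E →L[ℝ] E) : E →ₗ[ℝ] E) =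
      (A : E →ₗ[ℝ] E) ∘ₗ LinearMap.transvection (q • (innerSL ℝ x : E →ₗ[ℝ] ℝ)) z := by
    ext v
    simp [LinearMap.transvection.apply, hz, smul_smul]
  rw [ContinuousLinearMap.det, hcomp, LinearMap.det_comp, LinearMap.transvection.det]
  simp

/-- Both determinants are multiples of the same `det A`: the left factor is at most `1 + c ≤ exp c`,
the right one at least 1. -/
theorem abs_det_add_rankOne_le {A : E →L[ℝ] E} (hA : ∀ v, ‖v‖ ^ 2 ≤ inner ℝ (A v) v)
    {x x' : E} (hx : ‖x‖ ≤ 1) {q q' c : ℝ} (hqc : q ≤ c) (hc : 0 ≤ c) (hq : 0 ≤ q) (hq' : 0 ≤ q') :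
    |(A + q • (innerSL ℝ x).smulRight x).det| ≤
      Real.exp c * |(A + q' • (innerSL ℝ x').smulRight x').det| := by
  obtain ⟨r, hr, hr1, h⟩ := exists_det_add_rankOne hA x
  obtain ⟨r', hr', -, h'⟩ := exists_det_add_rankOne hA x'
  rw [h, h', abs_mul, abs_mul, mul_left_comm]
  refine mul_le_mul_of_nonneg_left ?_ (abs_nonneg _)
  have h1 : 0 ≤ q * r := mul_nonneg hq hr
  have h2 : 0 ≤ q' * r' := mul_nonneg hq' hr'
  rw [abs_of_nonneg (by linarith), abs_of_nonneg (by linarith)]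
  have h3 : r ≤ 1 := hr1.trans (pow_le_one₀ (norm_nonneg x) hx)
  have h4 : q * r ≤ c := by nlinarith
  have h5 := Real.add_one_le_exp c
  nlinarith [Real.exp_pos c]

end RankOneDet

/-! ### Comparison of product measures and of transformed noise laws. -/

section MeasureBounds

/-- The product outer measure is the largest one bounded on boxes by the product of the side
measures, so it suffices to compare on boxes, where only the factor `i₀` differs. The constant is
moved to the left as `c⁻¹` to make this maximality applicable. -/
theorem MeasureTheory.Measure.pi_le_smul {ι : Type*} [Fintype ι] {X : ι → Type*}
    [∀ i, MeasurableSpace (X i)] {μ ν : ∀ i, Measure (X i)} [∀ i, SigmaFinite (μ i)] {i₀ : ι}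
    {c : ENNReal} (hc0 : c ≠ 0) (hc : c ≠ ⊤) (h₀ : μ i₀ ≤ c • ν i₀) (h : ∀ i, i ≠ i₀ → μ i = ν i) :
    Measure.pi μ ≤ c • Measure.pi ν := by
  classical
  have hle : c⁻¹ • Measure.pi μ ≤ Measure.pi ν := by
    rw [← Measure.toOuterMeasure_le]
    have hpi : (Measure.pi ν).toOuterMeasure =
        (OuterMeasure.pi fun i => (ν i).toOuterMeasure).trim := by
      rw [Measure.pi, toMeasure_toOuterMeasure]
    rw [hpi]
    refine le_trans ?_ (OuterMeasure.le_trim _)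
    rw [OuterMeasure.le_pi]
    intro s _
    have hμ : (Measure.pi μ) (Set.univ.pi s) = ∏ i, μ i (s i) := Measure.pi_pi μ s
    change c⁻¹ * (Measure.pi μ) (Set.univ.pi s) ≤ ∏ i, ν i (s i)
    rw [hμ, ← Finset.mul_prod_erase _ _ (Finset.mem_univ i₀),
      ← Finset.mul_prod_erase _ (fun i => ν i (s i)) (Finset.mem_univ i₀), ← mul_assoc]
    refine mul_le_mul' ?_ (Finset.prod_congr rfl fun i hi => ?_).le
    · calc c⁻¹ * μ i₀ (s i₀) ≤ c⁻¹ * (c * ν i₀ (s i₀)) := by gcongr; exact h₀ (s i₀)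
        _ = ν i₀ (s i₀) := by rw [← mul_assoc, ENNReal.inv_mul_cancel hc0 hc, one_mul]
    · rw [h i (Finset.ne_of_mem_erase hi)]
  refine Measure.le_iff.2 fun s _ => ?_
  have := mul_le_mul_right (hle s) c
  simpa [← mul_assoc, ENNReal.mul_inv_cancel hc0 hc] using this

instance isFiniteMeasure_noiseMeasure (d : ℕ) (a : ℝ) : IsFiniteMeasure (noiseMeasure d a) := by
  refine ⟨?_⟩
  rw [noiseMeasure, Measure.smul_apply, withDensity_apply _ MeasurableSet.univ,
    Measure.restrict_univ, smul_eq_mul]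
  -- `Z⁻¹ * Z ≤ 1` holds even for `Z = 0` or `Z = ⊤`, so the normalizing integral need not be
  -- computed.
  exact (ENNReal.inv_mul_le_one _).trans_lt ENNReal.one_lt_top

variable {d : ℕ}

/-- The law of the solution `f` of `G f = w - ε`, for noise `ε`, computed by change of variables. -/
theorem map_noiseMeasure_apply {a : ℝ} {w : EuclideanSpace ℝ (Fin d)}
    {G step : EuclideanSpace ℝ (Fin d) → EuclideanSpace ℝ (Fin d)}
    {M : EuclideanSpace ℝ (Fin d) → EuclideanSpace ℝ (Fin d) →L[ℝ] EuclideanSpace ℝ (Fin d)}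
    (hG : Function.Injective G) (hM : ∀ f, HasFDerivAt G (M f) f) (hstep : ∀ e, G (step e) = w - e)
    (hmeas : Measurable step) {A : Set (EuclideanSpace ℝ (Fin d))} (hA : MeasurableSet A) :
    (noiseMeasure d a).map step A =
      (∫⁻ e : EuclideanSpace ℝ (Fin d), ENNReal.ofReal (Real.exp (-a * ‖e‖)))⁻¹ *
        ∫⁻ f in A, ENNReal.ofReal |(M f).det| * ENNReal.ofReal (Real.exp (-a * ‖w - G f‖)) := by
  -- `step` inverts `f ↦ w - G f`, so its preimages are images under a differentiable injective map,
  -- to which the change of variables formula applies.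
  have hpre : step ⁻¹' A = (fun f => w - G f) '' A := by
    ext e
    constructor
    · intro he
      exact ⟨step e, he, by simp [hstep]⟩
    · rintro ⟨f, hf, rfl⟩
      have : step (w - G f) = f := hG (by rw [hstep]; abel)
      simpa [this] using hf
  rw [Measure.map_apply hmeas hA, noiseMeasure, Measure.smul_apply,
    withDensity_apply _ (hmeas hA), hpre, smul_eq_mul,
    lintegral_image_eq_lintegral_abs_det_fderiv_mul volume hA (f' := fun f => -M f)
      (fun f _ => ((hM f).const_sub w).hasFDerivWithinAt)
      (fun f _ g _ hfg => hG (sub_right_injective hfg))]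
  congr 1
  refine lintegral_congr fun f => ?_
  have : |(-M f).det| = |(M f).det| := by
    have h1 : ((-M f : _ →L[ℝ] _) : EuclideanSpace ℝ (Fin d) →ₗ[ℝ] EuclideanSpace ℝ (Fin d)) =
        (-1 : ℝ) • (M f : EuclideanSpace ℝ (Fin d) →ₗ[ℝ] EuclideanSpace ℝ (Fin d)) := by
      ext; simp
    rw [ContinuousLinearMap.det, h1, LinearMap.det_smul, abs_mul, abs_pow]
    simp [ContinuousLinearMap.det]
  rw [this]

/-- The densities are compared pointwise: `hdet` bounds the Jacobians, and the triangle inequality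
with `hk` bounds the exponentials. The normalizing constants agree. -/
theorem map_noiseMeasure_le {a k c : ℝ} (ha : 0 ≤ a) {w : EuclideanSpace ℝ (Fin d)}
    {G G' step step' : EuclideanSpace ℝ (Fin d) → EuclideanSpace ℝ (Fin d)}
    {M M' : EuclideanSpace ℝ (Fin d) → EuclideanSpace ℝ (Fin d) →L[ℝ] EuclideanSpace ℝ (Fin d)}
    (hG : Function.Injective G) (hG' : Function.Injective G')
    (hM : ∀ f, HasFDerivAt G (M f) f) (hM' : ∀ f, HasFDerivAt G' (M' f) f)
    (hstep : ∀ e, G (step e) = w - e) (hstep' : ∀ e, G' (step' e) = w - e)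
    (hmeas : Measurable step) (hmeas' : Measurable step')
    (hk : ∀ f, ‖G f - G' f‖ ≤ k) (hdet : ∀ f, |(M f).det| ≤ Real.exp c * |(M' f).det|) :
    (noiseMeasure d a).map step ≤
      ENNReal.ofReal (Real.exp (c + a * k)) • (noiseMeasure d a).map step' := by
  refine Measure.le_iff.2 fun A hA => ?_
  rw [Measure.smul_apply, map_noiseMeasure_apply hG hM hstep hmeas hA,
    map_noiseMeasure_apply hG' hM' hstep' hmeas' hA, smul_eq_mul, mul_left_comm,
    ← lintegral_const_mul' _ _ ENNReal.ofReal_ne_top]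
  refine mul_le_mul' le_rfl (lintegral_mono fun f => ?_)
  rw [← ENNReal.ofReal_mul (abs_nonneg _), ← ENNReal.ofReal_mul (abs_nonneg _),
    ← ENNReal.ofReal_mul (Real.exp_nonneg _)]
  refine ENNReal.ofReal_le_ofReal ?_
  have h1 : Real.exp (-a * ‖w - G f‖) ≤ Real.exp (a * k) * Real.exp (-a * ‖w - G' f‖) := by
    rw [← Real.exp_add]
    refine Real.exp_le_exp.2 ?_
    have h2 : ‖w - G' f‖ ≤ ‖w - G f‖ + ‖G f - G' f‖ := by
      simpa using norm_add_le (w - G f) (G f - G' f)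
    nlinarith [hk f]
  calc |(M f).det| * Real.exp (-a * ‖w - G f‖)
      ≤ (Real.exp c * |(M' f).det|) * (Real.exp (a * k) * Real.exp (-a * ‖w - G' f‖)) :=
        mul_le_mul (hdet f) h1 (Real.exp_nonneg _) (by positivity)
    _ = Real.exp (c + a * k) * (|(M' f).det| * Real.exp (-a * ‖w - G' f‖)) := by
        rw [Real.exp_add]; ring

end MeasureBounds

/-! ### Gradient and Hessian of the local objective. -/

namespace Setup

variable {N d : ℕ} (S : Setup N d)

/-- The gradient of the local objective. -/
noncomputable def nodeGrad (D : S.Dataset) (i : Fin N) (f : EuclideanSpace ℝ (Fin d)) :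
    EuclideanSpace ℝ (Fin d) :=
  (S.C / S.B i) • ∑ n, ((D i n).y * deriv S.loss ((D i n).y * inner ℝ f (D i n).x)) • (D i n).x +
    (S.ρ / N) • gradient S.reg f

/-- The Hessian of the loss of one sample is this multiple of the rank-one operator `x xᵀ`. -/
noncomputable def curvature (s : Sample d) (f : EuclideanSpace ℝ (Fin d)) : ℝ :=
  s.y ^ 2 * deriv (deriv S.loss) (s.y * inner ℝ f s.x)

/-- The Hessian of the part of the local objective of node `i` that does not depend on sample `n₀`. -/
noncomputable def hessErase (D : S.Dataset) (i : Fin N) (n₀ : Fin (S.B i))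
    (f : EuclideanSpace ℝ (Fin d)) : EuclideanSpace ℝ (Fin d) →L[ℝ] EuclideanSpace ℝ (Fin d) :=
  (S.C / S.B i) • ∑ n ∈ Finset.univ.erase n₀,
    S.curvature (D i n) f • (innerSL ℝ (D i n).x).smulRight (D i n).x +
    (S.ρ / N) • fderiv ℝ (gradient S.reg) f

theorem _root_.Sample.sq_y (s : Sample d) : s.y ^ 2 = 1 := by
  rcases s.label with h | h <;> rw [h] <;> norm_num

theorem _root_.Sample.abs_y (s : Sample d) : |s.y| = 1 := by
  rcases s.label with h | h <;> rw [h] <;> norm_num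

variable {S}

theorem curvature_nonneg {c₁ : ℝ} (hL : LossCondition S.loss c₁) (s : Sample d)
    (f : EuclideanSpace ℝ (Fin d)) : 0 ≤ S.curvature s f := by
  rw [curvature, s.sq_y, one_mul]; exact (hL.deriv2_pos _).le

theorem curvature_le {c₁ : ℝ} (hL : LossCondition S.loss c₁) (s : Sample d)
    (f : EuclideanSpace ℝ (Fin d)) : S.curvature s f ≤ c₁ := by
  rw [curvature, s.sq_y, one_mul]; exact hL.deriv2_le _

theorem _root_.RegularizerCondition.convexOn {R : EuclideanSpace ℝ (Fin d) → ℝ}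
    (hR : RegularizerCondition R) : ConvexOn ℝ Set.univ R :=
  strongConvexOn_zero.1 (hR.strongConvex.mono zero_le_one)

theorem _root_.RegularizerCondition.hasFDerivAt {R : EuclideanSpace ℝ (Fin d) → ℝ}
    (hR : RegularizerCondition R) (f : EuclideanSpace ℝ (Fin d)) :
    HasFDerivAt R (innerSL ℝ (gradient R f)) f :=
  ((hR.contDiff.differentiable (by norm_num)) f).hasGradientAt.hasFDerivAt

theorem _root_.RegularizerCondition.hasFDerivAt_gradient {R : EuclideanSpace ℝ (Fin d) → ℝ}
    (hR : RegularizerCondition R) (f : EuclideanSpace ℝ (Fin d)) :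
    HasFDerivAt (gradient R) (fderiv ℝ (gradient R) f) f := by
  have h1 : Differentiable ℝ (fderiv ℝ R) :=
    (hR.contDiff.fderiv_right (m := 1) (by norm_num)).differentiable (by norm_num)
  have h2 : Differentiable ℝ (gradient R) := fun g =>
    ((InnerProductSpace.toDual ℝ (EuclideanSpace ℝ (Fin d))).symm.differentiable _).comp g (h1 g)
  exact (h2 f).hasFDerivAt

theorem convexOn_localObj {c₁ : ℝ} (hC : 0 < S.C) (hρ : 0 < S.ρ) (hL : LossCondition S.loss c₁)
    (hR : RegularizerCondition S.reg) (D : S.Dataset) (i : Fin N) :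
    ConvexOn ℝ Set.univ (S.localObj D i) := by
  have hsum : ConvexOn ℝ Set.univ
      (fun f => ∑ n, S.loss ((D i n).y * inner ℝ f (D i n).x)) := by
    have : ∀ s : Finset (Fin (S.B i)), ConvexOn ℝ Set.univ
        (fun f => ∑ n ∈ s, S.loss ((D i n).y * inner ℝ f (D i n).x)) := by
      intro s
      classical
      induction s using Finset.induction_on with
      | empty => simpa using convexOn_const (0 : ℝ) convex_univ
      | insert n s hn ih =>
        simp only [Finset.sum_insert hn]
        refine ConvexOn.add ?_ ih
        have := hL.strictConvex.convexOn.comp_linearMap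
          ((D i n).y • (innerSL ℝ (D i n).x : EuclideanSpace ℝ (Fin d) →ₗ[ℝ] ℝ))
        refine this.congr fun f _ => ?_
        simp [real_inner_comm]
    exact this _
  have h1 := hsum.smul (c := S.C / S.B i) (by positivity)
  have h2 := hR.convexOn.smul (c := S.ρ / N) (by positivity)
  exact (h1.add h2).congr fun f _ => by simp [localObj]

theorem hasFDerivAt_localObj {c₁ : ℝ} (hL : LossCondition S.loss c₁)
    (hR : RegularizerCondition S.reg) (D : S.Dataset) (i : Fin N)
    (f : EuclideanSpace ℝ (Fin d)) :
    HasFDerivAt (S.localObj D i) (innerSL ℝ (S.nodeGrad D i f)) f := by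
  have hlin : ∀ n, HasFDerivAt (fun f => S.loss ((D i n).y * inner ℝ f (D i n).x))
      (deriv S.loss ((D i n).y * inner ℝ f (D i n).x) • ((D i n).y • innerSL ℝ (D i n).x)) f := by
    intro n
    have h1 : HasFDerivAt (fun f => (D i n).y * inner ℝ f (D i n).x)
        ((D i n).y • innerSL ℝ (D i n).x) f := by
      have := ((innerSL ℝ (D i n).x).hasFDerivAt (x := f)).const_mul (D i n).y
      refine this.congr_of_eventuallyEq (Filter.Eventually.of_forall fun g => ?_)
      simp [real_inner_comm]
    exact ((hL.differentiable _).hasDerivAt).comp_hasFDerivAt f h1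
  have := ((HasFDerivAt.fun_sum fun n (_ : n ∈ Finset.univ) => hlin n).const_mul
    (S.C / S.B i)).add ((hR.hasFDerivAt f).const_mul (S.ρ / N))
  refine this.congr_fderiv ?_
  ext v
  simp only [nodeGrad, innerSL_apply_apply, add_apply, smul_apply, sum_apply, smul_eq_mul,
    inner_add_left, real_inner_smul_left, sum_inner]
  congr 2
  exact Finset.sum_congr rfl fun n _ => by ring

/-- Sample `n₀` is split off so that neighbouring datasets share the remaining operator and differ
only in the rank-one term. -/
theorem hasFDerivAt_nodeGrad {c₁ : ℝ} (hL : LossCondition S.loss c₁)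
    (hR : RegularizerCondition S.reg) (D : S.Dataset) (i : Fin N) (n₀ : Fin (S.B i))
    (f : EuclideanSpace ℝ (Fin d)) :
    HasFDerivAt (S.nodeGrad D i) (S.hessErase D i n₀ f +
      (S.C / S.B i * S.curvature (D i n₀) f) •
        (innerSL ℝ (D i n₀).x).smulRight (D i n₀).x) f := by
  have hlin : ∀ n, HasFDerivAt
      (fun f => ((D i n).y * deriv S.loss ((D i n).y * inner ℝ f (D i n).x)) • (D i n).x)
      (S.curvature (D i n) f • (innerSL ℝ (D i n).x).smulRight (D i n).x) f := by
    intro n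
    have h1 : HasFDerivAt (fun f => (D i n).y * inner ℝ f (D i n).x)
        ((D i n).y • innerSL ℝ (D i n).x) f := by
      have := ((innerSL ℝ (D i n).x).hasFDerivAt (x := f)).const_mul (D i n).y
      refine this.congr_of_eventuallyEq (Filter.Eventually.of_forall fun g => ?_)
      simp [real_inner_comm]
    have h2 := (((hL.differentiable_deriv _).hasDerivAt).comp_hasFDerivAt f h1).const_mul (D i n).y
    refine (h2.smul_const (D i n).x).congr_fderiv ?_
    ext1 v
    simp only [curvature, ContinuousLinearMap.smulRight_apply, smul_apply,
      smul_eq_mul, smul_smul]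
    congr 1
    ring
  have := ((HasFDerivAt.fun_sum fun n (_ : n ∈ Finset.univ) => hlin n).const_smul
    (S.C / S.B i)).add ((hR.hasFDerivAt_gradient f).const_smul (S.ρ / N))
  refine this.congr_fderiv ?_
  rw [hessErase, ← Finset.add_sum_erase _ _ (Finset.mem_univ n₀), smul_add, smul_smul]
  abel

theorem inner_hessErase_nonneg {c₁ : ℝ} (hC : 0 < S.C) (hρ : 0 < S.ρ)
    (hL : LossCondition S.loss c₁) (hR : RegularizerCondition S.reg) (D : S.Dataset) (i : Fin N)
    (n₀ : Fin (S.B i)) (f v : EuclideanSpace ℝ (Fin d)) :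
    0 ≤ inner ℝ (S.hessErase D i n₀ f v) v := by
  have hreg : 0 ≤ inner ℝ (fderiv ℝ (gradient S.reg) f v) v :=
    inner_fderiv_nonneg_of_monotone (hR.convexOn.inner_sub_nonneg hR.hasFDerivAt)
      (hR.hasFDerivAt_gradient f) v
  have hsum : 0 ≤ ∑ n ∈ Finset.univ.erase n₀,
      S.curvature (D i n) f * (inner ℝ (D i n).x v * inner ℝ (D i n).x v) :=
    Finset.sum_nonneg fun n _ => mul_nonneg (curvature_nonneg hL _ _) (mul_self_nonneg _)
  have : inner ℝ (S.hessErase D i n₀ f v) v = S.C / S.B i * ∑ n ∈ Finset.univ.erase n₀,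
      S.curvature (D i n) f * (inner ℝ (D i n).x v * inner ℝ (D i n).x v) +
      S.ρ / N * inner ℝ (fderiv ℝ (gradient S.reg) f v) v := by
    simp only [hessErase, innerSL_apply_apply, add_apply, smul_apply, sum_apply,
      ContinuousLinearMap.smulRight_apply, inner_add_left, real_inner_smul_left, sum_inner]
  rw [this]
  positivity

theorem hessErase_congr {D D' : S.Dataset} {i : Fin N} {n₀ : Fin (S.B i)}
    (h : ∀ n, n ≠ n₀ → D i n = D' i n) (f : EuclideanSpace ℝ (Fin d)) :
    S.hessErase D i n₀ f = S.hessErase D' i n₀ f := by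
  rw [hessErase, hessErase]
  congr 2
  exact Finset.sum_congr rfl fun n hn => by rw [h n (Finset.ne_of_mem_erase hn)]

/-- All terms cancel except those of sample `n₀`, one from each dataset, each of norm at most 1
because `|L'| ≤ 1`, `|y| = 1` and `‖x‖ ≤ 1`. -/
theorem norm_nodeGrad_sub_le {c₁ : ℝ} (hC : 0 < S.C) (hL : LossCondition S.loss c₁)
    {D D' : S.Dataset} (hD : S.IsNormalized D) (hD' : S.IsNormalized D') {i : Fin N}
    {n₀ : Fin (S.B i)} (h : ∀ n, n ≠ n₀ → D i n = D' i n) (f : EuclideanSpace ℝ (Fin d)) :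
    ‖S.nodeGrad D i f - S.nodeGrad D' i f‖ ≤ S.C / S.B i * 2 := by
  have hone : ∀ s : Sample d, ‖s.x‖ ≤ 1 →
      ‖(s.y * deriv S.loss (s.y * inner ℝ f s.x)) • s.x‖ ≤ 1 := by
    intro s hs
    rw [norm_smul, Real.norm_eq_abs, abs_mul, s.abs_y, one_mul]
    exact mul_le_one₀ (hL.abs_deriv_le _) (norm_nonneg _) hs
  have hdiff : S.nodeGrad D i f - S.nodeGrad D' i f = (S.C / S.B i) •
      (((D i n₀).y * deriv S.loss ((D i n₀).y * inner ℝ f (D i n₀).x)) • (D i n₀).x -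
      ((D' i n₀).y * deriv S.loss ((D' i n₀).y * inner ℝ f (D' i n₀).x)) • (D' i n₀).x) := by
    have hrest : ∑ n ∈ Finset.univ.erase n₀,
        ((D i n).y * deriv S.loss ((D i n).y * inner ℝ f (D i n).x)) • (D i n).x =
        ∑ n ∈ Finset.univ.erase n₀,
        ((D' i n).y * deriv S.loss ((D' i n).y * inner ℝ f (D' i n).x)) • (D' i n).x :=
      Finset.sum_congr rfl fun n hn => by rw [h n (Finset.ne_of_mem_erase hn)]
    rw [nodeGrad, nodeGrad, ← Finset.add_sum_erase _ _ (Finset.mem_univ n₀), hrest,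
      ← Finset.add_sum_erase _ (fun n => ((D' i n).y * deriv S.loss
        ((D' i n).y * inner ℝ f (D' i n).x)) • (D' i n).x) (Finset.mem_univ n₀),
      smul_add, smul_add, smul_sub]
    abel
  rw [hdiff, norm_smul, Real.norm_of_nonneg (by positivity)]
  refine mul_le_mul_of_nonneg_left ?_ (by positivity)
  refine (norm_sub_le _ _).trans ?_
  linarith [hone _ (hD i n₀), hone _ (hD' i n₀)]

end Setup

theorem argmin_le {E : Type*} [Nonempty E] {F : E → ℝ} (h : ∃ f, ∀ g, F f ≤ F g) (g : E) :
    F (argmin F) ≤ F g :=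
  Classical.epsilon_spec (p := fun f => ∀ g, F f ≤ F g) h g

/-! ### The private update of a single node. -/

namespace Setup

variable {N d : ℕ} (S : Setup N d)

/-- The value of `f + (2 η V)⁻¹ ∇O(f)` at the next iterate, in the absence of noise. -/
noncomputable def center (i : Fin N) (t : ℕ) (fp : Fin N → EuclideanSpace ℝ (Fin d))
    (lam : EuclideanSpace ℝ (Fin d)) : EuclideanSpace ℝ (Fin d) :=
  (1 / (2 * (S.η i t * S.V i))) •
    ((2 * S.η i t) • ∑ j ∈ S.nbrs i, (1 / 2 : ℝ) • (fp i + fp j) - (2 : ℝ) • lam)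

variable {S}

theorem continuous_center (i : Fin N) (t : ℕ) :
    Continuous fun p : (Fin N → EuclideanSpace ℝ (Fin d)) × EuclideanSpace ℝ (Fin d) =>
      S.center i t p.1 p.2 := by
  unfold center
  fun_prop

/-- Expanding the squares gives a convex function plus a linear term plus `η V ‖f‖²`, up to a
constant in `f` that does not affect the minimizer. -/
theorem privObj_eq (D : S.Dataset) (i : Fin N) (t : ℕ) (fp : Fin N → EuclideanSpace ℝ (Fin d))
    (lam e f : EuclideanSpace ℝ (Fin d)) :
    S.privObj D i t fp lam e f = S.localObj D i f +
      inner ℝ ((2 : ℝ) • lam + (2 * S.η i t) •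
        ∑ j ∈ S.nbrs i, (e - (1 / 2 : ℝ) • (fp i + fp j))) f + S.η i t * S.V i * ‖f‖ ^ 2 +
      S.η i t * ∑ j ∈ S.nbrs i, ‖e - (1 / 2 : ℝ) • (fp i + fp j)‖ ^ 2 := by
  have hsq : ∀ j, ‖f + e - (1 / 2 : ℝ) • (fp i + fp j)‖ ^ 2 = ‖f‖ ^ 2 +
      2 * inner ℝ (e - (1 / 2 : ℝ) • (fp i + fp j)) f +
      ‖e - (1 / 2 : ℝ) • (fp i + fp j)‖ ^ 2 := by
    intro j
    rw [add_sub_assoc, norm_add_sq_real, real_inner_comm]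
  simp only [privObj, hsq, Finset.sum_add_distrib, Finset.sum_const, nsmul_eq_mul, V,
    inner_add_left, real_inner_smul_left, sum_inner, ← Finset.mul_sum]
  ring

theorem regularizedMap_argmin {c₁ : ℝ} (hC : 0 < S.C) (hρ : 0 < S.ρ)
    (hL : LossCondition S.loss c₁) (hR : RegularizerCondition S.reg) (D : S.Dataset) {i : Fin N}
    {t : ℕ} (hη : 0 < S.η i t) (hV : 0 < S.V i) (fp : Fin N → EuclideanSpace ℝ (Fin d))
    (lam e : EuclideanSpace ℝ (Fin d)) :
    regularizedMap (1 / (2 * (S.η i t * S.V i))) (S.nodeGrad D i)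
      (argmin (S.privObj D i t fp lam e)) = S.center i t fp lam - e := by
  have hV' : (0 : ℝ) < S.V i := by exact_mod_cast hV
  have hc : 0 < S.η i t * S.V i := mul_pos hη hV'
  have hmin := argmin_le (F := S.privObj D i t fp lam e) <| by
    obtain ⟨a, ha⟩ := (convexOn_localObj hC hρ hL hR D i).exists_isMinOn_add_quadratic
      (hasFDerivAt_localObj hL hR D i) hc ((2 : ℝ) • lam + (2 * S.η i t) •
        ∑ j ∈ S.nbrs i, (e - (1 / 2 : ℝ) • (fp i + fp j)))
    refine ⟨a, fun g => ?_⟩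
    rw [privObj_eq, privObj_eq]
    linarith [ha g]
  have hfoc := regularizedMap_eq_of_isMin (hasFDerivAt_localObj hL hR D i) hc
    (l := (2 : ℝ) • lam + (2 * S.η i t) • ∑ j ∈ S.nbrs i, (e - (1 / 2 : ℝ) • (fp i + fp j)))
    (a := argmin (S.privObj D i t fp lam e)) fun g => by
      have := hmin g
      rw [privObj_eq, privObj_eq] at this
      linarith
  -- Each of the `V` neighbours contributes `2 η e` to the linear term, and the prefactor cancels `2
  -- η V`; hence the noise enters with coefficient exactly 1.
  have he : e = (1 / (2 * (S.η i t * S.V i))) • ((2 * S.η i t) • ((S.V i : ℝ) • e)) := by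
    rw [smul_smul, smul_smul]
    have : 1 / (2 * (S.η i t * S.V i)) * (2 * S.η i t) * S.V i = 1 := by field_simp
    rw [this, one_smul]
  rw [hfoc, center]
  conv_rhs => rw [he]
  rw [Finset.sum_sub_distrib, Finset.sum_const, ← Nat.cast_smul_eq_nsmul ℝ, neg_smul, ← smul_neg,
    ← smul_sub]
  congr 1
  simp only [V, smul_sub]
  abel

theorem antilipschitzWith_regularizedMap_nodeGrad {c₁ : ℝ} (hC : 0 < S.C) (hρ : 0 < S.ρ)
    (hL : LossCondition S.loss c₁) (hR : RegularizerCondition S.reg) (D : S.Dataset) (i : Fin N)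
    {κ : ℝ} (hκ : 0 ≤ κ) : AntilipschitzWith 1 (regularizedMap κ (S.nodeGrad D i)) :=
  antilipschitzWith_regularizedMap hκ ((convexOn_localObj hC hρ hL hR D i).inner_sub_nonneg
    (hasFDerivAt_localObj hL hR D i))

/-- The minimizer is the 1-Lipschitz inverse of the regularized map, evaluated at `center - e`. This
supplies the measurability of every later step. -/
theorem continuous_argmin_privObj {c₁ : ℝ} (hC : 0 < S.C) (hρ : 0 < S.ρ)
    (hL : LossCondition S.loss c₁) (hR : RegularizerCondition S.reg) (D : S.Dataset) {i : Fin N}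
    {t : ℕ} (hη : 0 < S.η i t) (hV : 0 < S.V i) :
    Continuous fun p : ((Fin N → EuclideanSpace ℝ (Fin d)) × EuclideanSpace ℝ (Fin d)) ×
      EuclideanSpace ℝ (Fin d) => argmin (S.privObj D i t p.1.1 p.1.2 p.2) := by
  have hc : 0 < S.η i t * S.V i := mul_pos hη (by exact_mod_cast hV)
  have hanti := antilipschitzWith_regularizedMap_nodeGrad hC hρ hL hR D i
    (κ := 1 / (2 * (S.η i t * S.V i))) (by positivity)
  have hinv := Function.rightInverse_surjInv (surjective_regularizedMap
    (convexOn_localObj hC hρ hL hR D i) (hasFDerivAt_localObj hL hR D i) hc)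
  have heq : (fun p : ((Fin N → EuclideanSpace ℝ (Fin d)) × EuclideanSpace ℝ (Fin d)) ×
      EuclideanSpace ℝ (Fin d) => argmin (S.privObj D i t p.1.1 p.1.2 p.2)) =
      fun p => Function.surjInv (surjective_regularizedMap
        (convexOn_localObj hC hρ hL hR D i) (hasFDerivAt_localObj hL hR D i) hc)
        (S.center i t p.1.1 p.1.2 - p.2) := by
    funext p
    refine hanti.injective ?_
    rw [regularizedMap_argmin hC hρ hL hR D hη hV, hinv]
  rw [heq]
  exact (hanti.to_rightInverse hinv).continuous.comp
    (((continuous_center i t).comp continuous_fst).sub continuous_snd)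

theorem hasFDerivAt_regularizedMap_nodeGrad {c₁ : ℝ} (hL : LossCondition S.loss c₁)
    (hR : RegularizerCondition S.reg) (D : S.Dataset) (i : Fin N) (n₀ : Fin (S.B i)) (κ : ℝ)
    (f : EuclideanSpace ℝ (Fin d)) :
    HasFDerivAt (regularizedMap κ (S.nodeGrad D i))
      (ContinuousLinearMap.id ℝ _ + κ • S.hessErase D i n₀ f +
        (κ * (S.C / S.B i * S.curvature (D i n₀) f)) •
          (innerSL ℝ (D i n₀).x).smulRight (D i n₀).x) f := by
  have := (hasFDerivAt_id f).add ((hasFDerivAt_nodeGrad hL hR D i n₀ f).const_smul κ)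
  refine this.congr_fderiv ?_
  rw [smul_add, smul_smul, add_assoc]

/-- Changing one sample of a node changes the law of its next iterate by a bounded factor. -/
theorem map_argmin_privObj_le {c₁ : ℝ} (hC : 0 < S.C) (hρ : 0 < S.ρ)
    (hL : LossCondition S.loss c₁) (hR : RegularizerCondition S.reg) {D D' : S.Dataset}
    (hD : S.IsNormalized D) (hD' : S.IsNormalized D') {i : Fin N} {n₀ : Fin (S.B i)}
    (h : ∀ n, n ≠ n₀ → D i n = D' i n) {t : ℕ} (hη : 0 < S.η i t) (hα : 0 < S.α i t)
    (hV : 0 < S.V i) (fp : Fin N → EuclideanSpace ℝ (Fin d)) (lam : EuclideanSpace ℝ (Fin d)) :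
    (noiseMeasure d (S.α i t)).map (fun e => argmin (S.privObj D i t fp lam e)) ≤
      ENNReal.ofReal (Real.exp (S.C * (1.4 * c₁ + S.α i t) / (S.η i t * S.V i * S.B i))) •
        (noiseMeasure d (S.α i t)).map (fun e => argmin (S.privObj D' i t fp lam e)) := by
  have hV' : (0 : ℝ) < S.V i := by exact_mod_cast hV
  have hB : (0 : ℝ) < S.B i := by exact_mod_cast n₀.pos
  have hc₁ : 0 < c₁ := (hL.deriv2_pos 0).trans_le (hL.deriv2_le 0)
  set κ : ℝ := 1 / (2 * (S.η i t * S.V i)) with hκ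
  have hκ0 : 0 < κ := by positivity
  have hmeas : ∀ D : S.Dataset, Measurable fun e => argmin (S.privObj D i t fp lam e) := fun D =>
    ((continuous_argmin_privObj hC hρ hL hR D hη hV).comp
      (Continuous.prodMk_right (fp, lam))).measurable
  have key := map_noiseMeasure_le hα.le (c := κ * (S.C / S.B i * c₁)) (k := κ * (S.C / S.B i * 2))
    (antilipschitzWith_regularizedMap_nodeGrad hC hρ hL hR D i hκ0.le).injective
    (antilipschitzWith_regularizedMap_nodeGrad hC hρ hL hR D' i hκ0.le).injective
    (hasFDerivAt_regularizedMap_nodeGrad hL hR D i n₀ κ)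
    (hasFDerivAt_regularizedMap_nodeGrad hL hR D' i n₀ κ)
    (regularizedMap_argmin hC hρ hL hR D hη hV fp lam)
    (regularizedMap_argmin hC hρ hL hR D' hη hV fp lam) (hmeas D) (hmeas D') ?_ ?_
  · refine key.trans (Measure.le_iff.2 fun A _ => ?_)
    simp only [Measure.smul_apply, smul_eq_mul]
    gcongr ENNReal.ofReal (Real.exp ?_) * _
    -- Since `2 η V κ = 1`, the constant `1.4` becomes `2.8` in units of `κ C / B`, whereas the
    -- determinant only needs `1`.
    have : S.C * (1.4 * c₁ + S.α i t) / (S.η i t * S.V i * S.B i) =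
        κ * (S.C / S.B i) * (2.8 * c₁) + S.α i t * (κ * (S.C / S.B i * 2)) := by
      rw [hκ]; field_simp; ring
    rw [this]
    have : 0 < κ * (S.C / S.B i) := by positivity
    nlinarith
  · intro f
    have : regularizedMap κ (S.nodeGrad D i) f - regularizedMap κ (S.nodeGrad D' i) f =
        κ • (S.nodeGrad D i f - S.nodeGrad D' i f) := by
      simp only [regularizedMap, smul_sub]; abel
    rw [this, norm_smul, Real.norm_of_nonneg hκ0.le]
    exact mul_le_mul_of_nonneg_left (norm_nodeGrad_sub_le hC hL hD hD' h f) hκ0.le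
  · intro f
    rw [← hessErase_congr h]
    have hA : ∀ v, ‖v‖ ^ 2 ≤
        inner ℝ ((ContinuousLinearMap.id ℝ (EuclideanSpace ℝ (Fin d)) + κ • S.hessErase D i n₀ f) v) v := by
      intro v
      have := mul_nonneg hκ0.le (inner_hessErase_nonneg hC hρ hL hR D i n₀ f v)
      simpa [inner_add_left, real_inner_smul_left] using this
    have hcurv := curvature_nonneg hL (D i n₀) f
    have hcurv' := curvature_nonneg hL (D' i n₀) f
    exact abs_det_add_rankOne_le hA (hD i n₀) (by gcongr; exact curvature_le hL _ _)
      (by positivity) (by positivity) (by positivity)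

end Setup

/-! ### The iteration as a Markov chain on histories. -/

namespace Setup

variable {N d : ℕ} (S : Setup N d)

/-- The primal iterates of `T` iterations together with the current dual variables. -/
abbrev History (_ : Setup N d) (T : ℕ) : Type :=
  (Fin (T + 1) → Fin N → EuclideanSpace ℝ (Fin d)) × (Fin N → EuclideanSpace ℝ (Fin d))

/-- The history produced by the algorithm. -/
noncomputable def history (T : ℕ) (D : S.Dataset) (ω : S.Randomness T) : S.History T :=
  (S.exchanged T D ω, (S.run D ω.1 (fun s => if h : s < T then ω.2 ⟨s, h⟩ else 0) T).2)

/-- The primal variables computed in iteration `T + 1`. -/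
noncomputable def primalStep (T : ℕ) (D : S.Dataset) (p : S.History T)
    (e : Fin N → EuclideanSpace ℝ (Fin d)) : Fin N → EuclideanSpace ℝ (Fin d) :=
  fun i => argmin (S.privObj D i (T + 1) (p.1 (Fin.last T)) (p.2 i) (e i))

/-- The history after the primal variables `f'` have been broadcast. -/
noncomputable def History.extend {S : Setup N d} {T : ℕ} (p : S.History T)
    (f' : Fin N → EuclideanSpace ℝ (Fin d)) : S.History (T + 1) :=
  (Fin.snoc (α := fun _ => Fin N → EuclideanSpace ℝ (Fin d)) p.1 f',
    fun i => p.2 i + (S.θ / 2) • ∑ j ∈ S.nbrs i, (f' i - f' j))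

/-- The joint law of the noise vectors of all nodes in iteration `t`. -/
noncomputable def stepNoise (t : ℕ) : Measure (Fin N → EuclideanSpace ℝ (Fin d)) :=
  Measure.pi fun i => noiseMeasure d (S.α i t)

instance (t : ℕ) : IsFiniteMeasure (S.stepNoise t) := by
  unfold stepNoise; infer_instance

variable {S}

/-- The first `t` iterations see only the first `t` noise vectors, so the value 0 used beyond the
horizon is immaterial. -/
theorem run_congr (D : S.Dataset) (f0 : Fin N → EuclideanSpace ℝ (Fin d))
    {e e' : ℕ → Fin N → EuclideanSpace ℝ (Fin d)} {t : ℕ} (h : ∀ s < t, e s = e' s) :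
    S.run D f0 e t = S.run D f0 e' t := by
  induction t with
  | zero => rfl
  | succ t ih =>
    have h1 := ih fun s hs => h s (hs.trans t.lt_succ_self)
    simp only [run, h1, h t t.lt_succ_self]

/-- The Markov property: carrying the duals along makes the next history a function of the present
one and fresh noise. -/
theorem history_succ (T : ℕ) (D : S.Dataset) (f0 : Fin N → EuclideanSpace ℝ (Fin d))
    (e : Fin T → Fin N → EuclideanSpace ℝ (Fin d)) (x : Fin N → EuclideanSpace ℝ (Fin d)) :
    S.history (T + 1) D (f0, Fin.snoc (α := fun _ => Fin N → EuclideanSpace ℝ (Fin d)) e x) =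
      (S.history T D (f0, e)).extend (S.primalStep T D (S.history T D (f0, e)) x) := by
  set E₁ : ℕ → Fin N → EuclideanSpace ℝ (Fin d) := fun s => if h : s < T + 1 then
    Fin.snoc (α := fun _ => Fin N → EuclideanSpace ℝ (Fin d)) e x ⟨s, h⟩ else 0 with hE₁
  set E₀ : ℕ → Fin N → EuclideanSpace ℝ (Fin d) := fun s => if h : s < T then e ⟨s, h⟩ else 0
    with hE₀
  have hE : ∀ s < T, E₁ s = E₀ s := by
    intro s hs
    simp [hE₁, hE₀, hs, hs.le, Fin.snoc]
  have hrun : ∀ t ≤ T, S.run D f0 E₁ t = S.run D f0 E₀ t := fun t ht =>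
    run_congr D f0 fun s hs => hE s (hs.trans_le ht)
  have hx : E₁ T = x := by simp [hE₁, Fin.snoc]
  have hstep : (S.run D f0 E₁ (T + 1)).1 = S.primalStep T D (S.history T D (f0, e)) x := by
    simp only [run, hrun T le_rfl, hx]
    rfl
  refine Prod.ext (funext fun t => ?_) ?_
  · change (S.run D f0 E₁ t).1 = Fin.snoc (α := fun _ => Fin N → EuclideanSpace ℝ (Fin d)) _ _ t
    refine Fin.lastCases ?_ (fun t => ?_) t
    · rw [Fin.snoc_last]
      exact hstep
    · rw [Fin.snoc_castSucc, Fin.val_castSucc, hrun t (Nat.lt_succ_iff.1 t.2)]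
      rfl
  · change (S.run D f0 E₁ (T + 1)).2 = _
    rw [History.extend, ← hstep]
    simp only [run, hrun T le_rfl]
    rfl

theorem measurePreserving_snoc (T : ℕ) (μ₀ : Measure (Fin N → EuclideanSpace ℝ (Fin d)))
    [IsProbabilityMeasure μ₀] :
    MeasurePreserving (fun p : S.Randomness T × (Fin N → EuclideanSpace ℝ (Fin d)) =>
      ((p.1.1, Fin.snoc (α := fun _ => Fin N → EuclideanSpace ℝ (Fin d)) p.1.2 p.2) :
        S.Randomness (T + 1)))
      ((S.randLaw T μ₀).prod (S.stepNoise (T + 1))) (S.randLaw (T + 1) μ₀) := by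
  have h1 := measurePreserving_prodAssoc μ₀ (Measure.pi fun t : Fin T => S.stepNoise ((t : ℕ) + 1))
    (S.stepNoise (T + 1))
  have h2 := (measurePreserving_piFinSuccAbove
    (fun t : Fin (T + 1) => S.stepNoise ((t : ℕ) + 1)) (Fin.last T)).symm
  simp only [Fin.succAbove_last, Fin.val_last, Fin.val_castSucc] at h2
  have h3 := h2.comp (Measure.measurePreserving_swap
    (μ := Measure.pi fun t : Fin T => S.stepNoise ((t : ℕ) + 1)) (ν := S.stepNoise (T + 1)))
  have h4 := ((MeasurePreserving.id μ₀).prod h3).comp h1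
  have hlaw : ∀ T, S.randLaw T μ₀ =
      μ₀.prod (Measure.pi fun t : Fin T => S.stepNoise ((t : ℕ) + 1)) := fun _ => rfl
  rw [hlaw, hlaw]
  convert h4 using 2 with p
  refine Prod.ext rfl ?_
  change _ = Fin.insertNth _ _ _
  rw [Fin.insertNth_last]
  rfl

theorem measurable_extend (T : ℕ) : Measurable fun p : S.History T ×
    (Fin N → EuclideanSpace ℝ (Fin d)) => p.1.extend p.2 := by
  refine Measurable.prodMk (measurable_pi_lambda _ fun t => ?_) (by fun_prop)
  refine Fin.lastCases ?_ (fun t => ?_) t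
  · simpa only [Fin.snoc_last] using measurable_snd
  · simp only [Fin.snoc_castSucc]
    fun_prop

theorem measurable_primalStep {c₁ : ℝ} (hC : 0 < S.C) (hρ : 0 < S.ρ)
    (hL : LossCondition S.loss c₁) (hR : RegularizerCondition S.reg) (D : S.Dataset) {T : ℕ}
    (hη : ∀ i, 0 < S.η i (T + 1)) (hV : ∀ i, 0 < S.V i) :
    Measurable fun p : S.History T × (Fin N → EuclideanSpace ℝ (Fin d)) =>
      S.primalStep T D p.1 p.2 := by
  refine measurable_pi_lambda _ fun i => ?_
  simp only [primalStep]
  have h1 := (continuous_argmin_privObj hC hρ hL hR D (hη i) (hV i)).measurable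
  have h2 : Measurable fun p : S.History T × (Fin N → EuclideanSpace ℝ (Fin d)) =>
      ((p.1.1 (Fin.last T), p.1.2 i), p.2 i) := by fun_prop
  have h3 := h1.comp h2
  simp only [Function.comp_def] at h3
  exact h3

theorem measurable_extend_primalStep {c₁ : ℝ} (hC : 0 < S.C) (hρ : 0 < S.ρ)
    (hL : LossCondition S.loss c₁) (hR : RegularizerCondition S.reg) (D : S.Dataset) {T : ℕ}
    (hη : ∀ i, 0 < S.η i (T + 1)) (hV : ∀ i, 0 < S.V i) :
    Measurable fun p : S.History T × (Fin N → EuclideanSpace ℝ (Fin d)) =>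
      p.1.extend (S.primalStep T D p.1 p.2) := by
  have h1 := measurable_fst.prodMk (measurable_primalStep (T := T) hC hρ hL hR D hη hV)
  exact (measurable_extend T).comp h1

theorem measurable_history {c₁ : ℝ} (hC : 0 < S.C) (hρ : 0 < S.ρ)
    (hL : LossCondition S.loss c₁) (hR : RegularizerCondition S.reg) (D : S.Dataset) {T : ℕ}
    (hη : ∀ i, ∀ t ∈ Finset.Icc 1 T, 0 < S.η i t) (hV : ∀ i, 0 < S.V i) :
    Measurable (S.history T D) := by
  induction T with
  | zero =>
    refine Measurable.prodMk (measurable_pi_lambda _ fun t => ?_) measurable_const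
    obtain rfl : t = 0 := Fin.ext (by omega)
    exact measurable_fst
  | succ T ih =>
    have hT := ih fun i t ht => hη i t (Finset.Icc_subset_Icc_right T.le_succ ht)
    have hstep := measurable_primalStep hC hρ hL hR D (T := T)
      (fun i => hη i _ (by simp)) hV
    have heq : S.history (T + 1) D = fun ω =>
        (S.history T D (ω.1, fun t => ω.2 t.castSucc)).extend
          (S.primalStep T D (S.history T D (ω.1, fun t => ω.2 t.castSucc)) (ω.2 (Fin.last T))) := by
      funext ω
      rw [← history_succ]
      congr 1
      exact Prod.ext rfl (Fin.snoc_init_self ω.2).symm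
    rw [heq]
    have h1 : Measurable fun ω : S.Randomness (T + 1) =>
        S.history T D (ω.1, fun t => ω.2 t.castSucc) := hT.comp (by fun_prop)
    exact (measurable_extend T).comp (h1.prodMk (hstep.comp (h1.prodMk (by fun_prop))))

/-- The history after one more iteration is a transition of the history before it. -/
theorem map_history_succ {c₁ : ℝ} (hC : 0 < S.C) (hρ : 0 < S.ρ)
    (hL : LossCondition S.loss c₁) (hR : RegularizerCondition S.reg) (D : S.Dataset) {T : ℕ}
    (hη : ∀ i, ∀ t ∈ Finset.Icc 1 (T + 1), 0 < S.η i t) (hV : ∀ i, 0 < S.V i)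
    (μ₀ : Measure (Fin N → EuclideanSpace ℝ (Fin d))) [IsProbabilityMeasure μ₀] :
    (S.randLaw (T + 1) μ₀).map (S.history (T + 1) D) =
      (((S.randLaw T μ₀).map (S.history T D)).prod (S.stepNoise (T + 1))).map
        fun p => p.1.extend (S.primalStep T D p.1 p.2) := by
  have hT := measurable_history hC hρ hL hR D (T := T)
    (fun i t ht => hη i t (Finset.Icc_subset_Icc_right T.le_succ ht)) hV
  have hstep := measurable_extend_primalStep hC hρ hL hR D (T := T)
    (fun i => hη i _ (by simp)) hV
  have : SFinite (S.randLaw T μ₀) := by unfold randLaw; infer_instance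
  have hprod : ((S.randLaw T μ₀).map (S.history T D)).prod (S.stepNoise (T + 1)) =
      ((S.randLaw T μ₀).prod (S.stepNoise (T + 1))).map (Prod.map (S.history T D) id) := by
    rw [← Measure.map_prod_map _ _ hT measurable_id, Measure.map_id]
  rw [← (measurePreserving_snoc (S := S) T μ₀).map_eq,
    Measure.map_map (measurable_history hC hρ hL hR D hη hV)
      (measurePreserving_snoc (S := S) T μ₀).measurable,
    hprod, Measure.map_map hstep (hT.prodMap measurable_id)]
  congr 1
  funext p
  exact history_succ T D p.1.1 p.1.2 p.2

/-- For a fixed past the nodes use independent noise, so the joint law is a product in which only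
the factor of `i₀` depends on the changed sample. -/
theorem map_primalStep_le {c₁ : ℝ} (hC : 0 < S.C) (hρ : 0 < S.ρ)
    (hL : LossCondition S.loss c₁) (hR : RegularizerCondition S.reg) {D D' : S.Dataset}
    (hD : S.IsNormalized D) (hD' : S.IsNormalized D') {i₀ : Fin N} {n₀ : Fin (S.B i₀)}
    (h : ∀ n, n ≠ n₀ → D i₀ n = D' i₀ n) (h' : ∀ i, i ≠ i₀ → D i = D' i) {T : ℕ}
    (hη : ∀ i, 0 < S.η i (T + 1)) (hα : ∀ i, 0 < S.α i (T + 1)) (hV : ∀ i, 0 < S.V i)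
    (p : S.History T) :
    (S.stepNoise (T + 1)).map (S.primalStep T D p) ≤
      ENNReal.ofReal (Real.exp (S.C * (1.4 * c₁ + S.α i₀ (T + 1)) /
        (S.η i₀ (T + 1) * S.V i₀ * S.B i₀))) • (S.stepNoise (T + 1)).map (S.primalStep T D' p) := by
  have hmeas : ∀ (D : S.Dataset) (i : Fin N), Measurable fun e =>
      argmin (S.privObj D i (T + 1) (p.1 (Fin.last T)) (p.2 i) e) := fun D i =>
    ((continuous_argmin_privObj hC hρ hL hR D (hη i) (hV i)).comp
      (Continuous.prodMk_right (p.1 (Fin.last T), p.2 i))).measurable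
  have hpi : ∀ D : S.Dataset, (S.stepNoise (T + 1)).map (S.primalStep T D p) =
      Measure.pi fun i => (noiseMeasure d (S.α i (T + 1))).map fun e =>
        argmin (S.privObj D i (T + 1) (p.1 (Fin.last T)) (p.2 i) e) := fun D =>
    Measure.pi_map_pi fun i => (hmeas D i).aemeasurable
  rw [hpi, hpi]
  refine Measure.pi_le_smul (i₀ := i₀) (by simp [Real.exp_pos]) ENNReal.ofReal_ne_top
    (map_argmin_privObj_le hC hρ hL hR hD hD' h (hη i₀) (hα i₀) (hV i₀) _ _) fun i hi => ?_
  have : S.privObj D i = S.privObj D' i := by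
    funext t fp lam e f
    simp only [privObj, localObj, h' i hi]
  rw [this]

theorem map_history_le {c₁ : ℝ} (hC : 0 < S.C) (hρ : 0 < S.ρ)
    (hL : LossCondition S.loss c₁) (hR : RegularizerCondition S.reg) {D D' : S.Dataset}
    (hD : S.IsNormalized D) (hD' : S.IsNormalized D') {i₀ : Fin N} {n₀ : Fin (S.B i₀)}
    (h : ∀ n, n ≠ n₀ → D i₀ n = D' i₀ n) (h' : ∀ i, i ≠ i₀ → D i = D' i) {T : ℕ}
    (hη : ∀ i, ∀ t ∈ Finset.Icc 1 T, 0 < S.η i t) (hα : ∀ i, ∀ t ∈ Finset.Icc 1 T, 0 < S.α i t)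
    (hV : ∀ i, 0 < S.V i) (μ₀ : Measure (Fin N → EuclideanSpace ℝ (Fin d)))
    [IsProbabilityMeasure μ₀] :
    (S.randLaw T μ₀).map (S.history T D) ≤
      ENNReal.ofReal (Real.exp (∑ t ∈ Finset.Icc 1 T,
        S.C * (1.4 * c₁ + S.α i₀ t) / (S.η i₀ t * S.V i₀ * S.B i₀))) •
        (S.randLaw T μ₀).map (S.history T D') := by
  induction T with
  | zero =>
    have : S.history 0 D = S.history 0 D' := by
      funext ω
      refine Prod.ext (funext fun t => ?_) rfl
      obtain rfl : t = 0 := Fin.ext (by omega)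
      rfl
    simp [this]
  | succ T ih =>
    have hsub : Finset.Icc 1 T ⊆ Finset.Icc 1 (T + 1) := Finset.Icc_subset_Icc_right T.le_succ
    have hT := ih (fun i t ht => hη i t (hsub ht)) (fun i t ht => hα i t (hsub ht))
    have hη' : ∀ i, 0 < S.η i (T + 1) := fun i => hη i _ (by simp)
    have hα' : ∀ i, 0 < S.α i (T + 1) := fun i => hα i _ (by simp)
    have hmeas : ∀ D : S.Dataset, Measurable fun p : S.History T ×
        (Fin N → EuclideanSpace ℝ (Fin d)) => p.1.extend (S.primalStep T D p.1 p.2) := fun D =>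
      measurable_extend_primalStep hC hρ hL hR D hη' hV
    have hstep : ∀ (D : S.Dataset) (p : S.History T), Measurable (S.primalStep T D p) := fun D p =>
      Measurable.of_uncurry_left (f := S.primalStep T D)
        (measurable_primalStep hC hρ hL hR D hη' hV)
    refine Measure.le_iff.2 fun A hA => ?_
    rw [map_history_succ hC hρ hL hR D hη hV, map_history_succ hC hρ hL hR D' hη hV,
      Measure.smul_apply, Measure.map_apply (hmeas D) hA, Measure.map_apply (hmeas D') hA,
      Measure.prod_apply (hmeas D hA), Measure.prod_apply (hmeas D' hA),
      Finset.sum_Icc_succ_top (by omega), Real.exp_add, ENNReal.ofReal_mul (Real.exp_nonneg _),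
      smul_eq_mul, mul_assoc, ← lintegral_const_mul' _ _ ENNReal.ofReal_ne_top, ← smul_eq_mul,
      ← lintegral_smul_measure]
    -- The induction hypothesis compares the laws of the past, and the one-step bound compares the
    -- conditional probabilities; the two factors multiply.
    refine lintegral_mono' hT fun p => ?_
    have hA' : MeasurableSet (p.extend ⁻¹' A) :=
      ((measurable_extend T).comp measurable_prodMk_left) hA
    have := map_primalStep_le hC hρ hL hR hD hD' h h' hη' hα' hV p (p.extend ⁻¹' A)
    rwa [Measure.smul_apply, Measure.map_apply (hstep D p) hA',
      Measure.map_apply (hstep D' p) hA'] at this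

theorem V_pos (hN : 2 ≤ N) (hG : S.graph.Connected) (i : Fin N) : 0 < S.V i := by
  have : Nontrivial (Fin N) := Fin.nontrivial_iff_two_le.2 hN
  obtain ⟨j, hj⟩ := hG.preconnected.exists_adj_of_nontrivial i
  exact Finset.card_pos.2 ⟨j, by simpa [nbrs] using hj⟩

/-- The index `k` covers equal datasets, where no sample differs but one must still be named. -/
theorem Neighboring.exists_eq_of_ne {D D' : S.Dataset} (h : S.Neighboring D D')
    (k : (i : Fin N) × Fin (S.B i)) :
    ∃ (i₀ : Fin N) (n₀ : Fin (S.B i₀)), (∀ n, n ≠ n₀ → D i₀ n = D' i₀ n) ∧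
      ∀ i, i ≠ i₀ → D i = D' i := by
  obtain ⟨k₀, hk₀⟩ : ∃ k₀, {k : (i : Fin N) × Fin (S.B i) | D k.1 k.2 ≠ D' k.1 k.2} ⊆ {k₀} := by
    have : Nonempty ((i : Fin N) × Fin (S.B i)) := ⟨k⟩
    exact (Set.ncard_le_one_iff_subset_singleton (Set.toFinite _)).1 h
  refine ⟨k₀.1, k₀.2, fun n hn => ?_, fun i hi => funext fun n => ?_⟩
  · by_contra hne
    have : (⟨k₀.1, n⟩ : (i : Fin N) × Fin (S.B i)) = k₀ := hk₀ hne
    exact hn (eq_of_heq (Sigma.mk.inj_iff.1 (this.trans (Sigma.eta k₀).symm)).2)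
  · by_contra hne
    have : (⟨i, n⟩ : (i : Fin N) × Fin (S.B i)) = k₀ := hk₀ hne
    exact hi (congrArg Sigma.fst this)

end Setup

/-! ### Conclusion: projecting histories to iterates. -/

theorem theorem3 {N d : ℕ} (S : Setup N d) (T : ℕ) (c₁ β : ℝ)
    (μ₀ : MeasureTheory.Measure (Fin N → EuclideanSpace ℝ (Fin d)))
    [MeasureTheory.IsProbabilityMeasure μ₀]
    (hN : 2 ≤ N) (hG : S.graph.Connected)
    (hC : 0 < S.C) (hCB : ∀ i, S.C ≤ S.B i) (hρ : 0 < S.ρ)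
    (hL : LossCondition S.loss c₁) (hR : RegularizerCondition S.reg)
    (hθ : ∀ i, 2 * c₁ < S.B i / S.C * (S.ρ / N + 2 * S.θ * S.V i))
    (hη : ∀ i, ∀ t ∈ Finset.Icc 1 T, 0 < S.η i t)
    (hα : ∀ i, ∀ t ∈ Finset.Icc 1 T, 0 < S.α i t)
    (hβ : (⨆ i, ∑ t ∈ Finset.Icc 1 T,
      S.C * (1.4 * c₁ + S.α i t) / (S.η i t * S.V i * S.B i)) ≤ β) :
    S.IsDifferentiallyPrivate T μ₀ β := by
  intro D D' hD hD' hDD' A hA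
  have hV := fun i => Setup.V_pos hN hG i
  have hB : ∀ i, 0 < S.B i := fun i => by exact_mod_cast hC.trans_le (hCB i)
  -- Some sample exists because `N ≥ 2` and `0 < C ≤ B i`.
  obtain ⟨i₀, n₀, h, h'⟩ := hDD'.exists_eq_of_ne
    ⟨⟨0, by omega⟩, ⟨0, hB _⟩⟩
  have key := Setup.map_history_le hC hρ hL hR hD hD' h h' hη hα hV μ₀ (Prod.fst ⁻¹' A)
  have hA' : MeasurableSet (Prod.fst ⁻¹' A : Set (S.History T)) := measurable_fst hA
  rw [Measure.smul_apply, Measure.map_apply (Setup.measurable_history hC hρ hL hR D hη hV) hA',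
    Measure.map_apply (Setup.measurable_history hC hρ hL hR D' hη hV) hA'] at key
  refine key.trans (mul_le_mul' (ENNReal.ofReal_le_ofReal (Real.exp_le_exp.2 ?_)) le_rfl)
  exact (le_ciSup (f := fun i => ∑ t ∈ Finset.Icc 1 T,
    S.C * (1.4 * c₁ + S.α i t) / (S.η i t * S.V i * S.B i)) (Set.finite_range _).bddAbove i₀).trans hβ
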